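/- Let $\mathbb Z^3$ carry its nearest-neighbour graph structure ($m\sim n$ iff $m-n=\pm e_i$ for some $i$). For $\sigma\ge 0$ let $$G_\sigma(x)=\frac1{(2\pi)^3}\int_{[-\pi,\pi]^3}\frac{\cos(x_1\theta_1)\cos(x_2\theta_2)\cos(x_3\theta_3)}{6+\sigma-2(\cos\theta_1+\cos\theta_2+\cos\theta_3)}\,d\theta,\qquad x\in\mathbb Z^3,$$ be the lattice Green's function of $-\Delta+\sigma$ on $\mathbb Z^3$. For $\Omega_h\subset\mathbb Z^3$ let $N^+$ be the set of nodes that belong to $\Omega_h$ or have a neighbour in $\Omega_h$, let $\gamma_-=N^+\setminus\Omega_h$ be its exterior grid boundary, and for $n\in\gamma_-$ let $\mathbb D_n$ be the set of neighbours of $n$ that do not belong to $N^+$. The double-layer kernel is $$D(m,n)=\sum_{k\in\mathbb D_n}\bigl(G_\sigma(m-n)-G_\sigma(m-k)\bigr),$$ and $D_-=\bigl(D(m,n)\bigr)_{m,n\in\gamma_-}$ is the matrix of the double-layer potential on $\gamma_-$. **Theorem.** There is an absolute constant $C>0$ such that the following holds for every $\sigma\ge0$, every nonempty connected $\Omega_h\subset\mathbb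 Z^3$ whose boundary $\gamma_-$ is finite, with $N$ nodes, and every real $c$ with $0<c\le1$. Suppose that there is an ordering $\{m_1,\dots,m_N\}$ of $\gamma_-$ such that for all $i\ne j$ $$|m_i-m_j|\ge c\,d(i,j),\qquad d(i,j)=\min\bigl(|i-j|,\,N-|i-j|\bigr),$$ where $|\cdot|$ on $\mathbb Z^3$ is the Euclidean norm. Then $$\|D_-\|\le \frac{C}{c^2},$$ where $\|\cdot\|$ is the operator norm induced by the Euclidean norm. In particular, $C$ does not depend on $N$. -/

import Mathlib

namespace LatticeBAE

/-- The nearest-neighbour graph on `ℤ³`: two nodes are joined when they differ by `±1` in exactly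
one coordinate (the off-centre nodes of the seven-point stencil). -/
def lattice : SimpleGraph (Fin 3 → ℤ) where
  Adj m n := ∑ i, |m i - n i| = 1
  symm := ⟨fun m n h => by simpa only [abs_sub_comm] using h⟩
  loopless := ⟨fun m h => by simp at h⟩

/-- The nodes needed by the seven-point stencil centred at the points of `M`. -/
def stencil (M : Set (Fin 3 → ℤ)) : Set (Fin 3 → ℤ) :=
  {m | m ∈ M ∨ ∃ p ∈ M, lattice.Adj p m}

/-- The discrete grid boundary `γ = N⁺ ∩ N⁻` of `M`, where `N⁺`, `N⁻` are the stencil sets of `M`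
and of its complement. -/
def gridBoundary (M : Set (Fin 3 → ℤ)) : Set (Fin 3 → ℤ) :=
  stencil M ∩ stencil Mᶜ

/-- The exterior part `γ₋` of the grid boundary of `M`. -/
def gammaMinus (M : Set (Fin 3 → ℤ)) : Set (Fin 3 → ℤ) :=
  gridBoundary M \ M

/-- The lattice Green's function `G_σ` of `-Δ + σ` on `ℤ³` with mesh width one. For `σ = 0` the
integrand is singular at the origin only, and Lebesgue integrable. -/
noncomputable def latticeGreen (σ : ℝ) (x : Fin 3 → ℤ) : ℝ :=
  1 / (2 * Real.pi) ^ 3 *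
    ∫ θ : Fin 3 → ℝ in Set.univ.pi (fun _ => Set.Icc (-Real.pi) Real.pi),
      (∏ i, Real.cos (x i * θ i)) / (6 + σ - 2 * ∑ i, Real.cos (θ i))

/-- `𝔻ₙ`: the lattice neighbours of `n` that lie outside the stencil set `N⁺` of `M`. -/
def outerNeighbors (M : Set (Fin 3 → ℤ)) (n : Fin 3 → ℤ) : Set (Fin 3 → ℤ) :=
  {k | lattice.Adj n k ∧ k ∉ stencil M}

theorem outerNeighbors_finite (M : Set (Fin 3 → ℤ)) (n : Fin 3 → ℤ) :
    (outerNeighbors M n).Finite := by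
  refine (Set.finite_Icc (fun i => n i - 1) (fun i => n i + 1)).subset ?_
  rintro k ⟨hk, -⟩
  have hk' : ∑ i, |n i - k i| = 1 := hk
  have h : ∀ i, |n i - k i| ≤ 1 := fun i => by
    rw [← hk']
    exact Finset.single_le_sum (f := fun i => |n i - k i|) (fun j _ => abs_nonneg _)
      (Finset.mem_univ i)
  refine ⟨fun i => ?_, fun i => ?_⟩
  · have := (abs_le.1 (h i)).2
    show n i - 1 ≤ k i
    omega
  · have := (abs_le.1 (h i)).1
    show k i ≤ n i + 1
    omega

/-- The double-layer kernel `D(m, n) = ∑_{k ∈ 𝔻ₙ} (G_σ(m - n) - G_σ(m - k))`. -/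
noncomputable def doubleLayerKernel (σ : ℝ) (M : Set (Fin 3 → ℤ)) (m n : Fin 3 → ℤ) : ℝ :=
  ∑ k ∈ (outerNeighbors_finite M n).toFinset, (latticeGreen σ (m - n) - latticeGreen σ (m - k))

/-- The matrix `D₋` of the double-layer potential: targets and sources both in `γ₋`. -/
noncomputable def doubleLayerMatrix (σ : ℝ) (M : Set (Fin 3 → ℤ)) :
    Matrix (gammaMinus M) (gammaMinus M) ℝ :=
  Matrix.of fun m n => doubleLayerKernel σ M m n

/-- Euclidean distance between two nodes of `ℤ³`. -/
noncomputable def nodeDist (m n : Fin 3 → ℤ) : ℝ :=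
  Real.sqrt (∑ i, ((m i : ℝ) - (n i : ℝ)) ^ 2)

/-- The cyclic index distance `min (|i - j|, N - |i - j|)`. -/
def cyclicDist {N : ℕ} (i j : Fin N) : ℤ :=
  min |(i : ℤ) - (j : ℤ)| ((N : ℤ) - |(i : ℤ) - (j : ℤ)|)

end LatticeBAE

namespace LatticeBAE

open Real MeasureTheory Set

/-! A Schur test bounds the norm by absolute row and column sums, so it suffices that `|D(m, n)| ≤ K
/ (1 + |m - n|²)` with `K` independent of `σ` and `Ω_h`. Along an ordering with `|m_i - m_j| ≥ c
d(i, j)`, such a row is dominated by `c⁻² ∑ 1 / (1 + d²)`, a convergent series over `ℤ`.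

The kernel bound follows from the gradient estimate `abs_latticeGreen_sub_le`. The Green's function
is the time integral of `exp (-σ t)` times a product of three one-dimensional heat kernels.
Integration by parts in `θ` shows that these live on the scale `n² ~ 1 + t`, and that a unit
difference gains a factor `(1 + t)^(-1/2)`. Hence the difference of products is `O((1 + t +
|x|²)⁻²)` (`abs_prod_heatCoeff_sub_le`), whose integral over `t > 0` is `O((1 + |x|²)⁻¹)`. As `exp
(-σ t) ≤ 1`, nothing depends on `σ`. -/

/-! ### Gaussian moment bounds for the heat multiplier. -/

/-- The Fourier multiplier `exp (-t (2 - 2 cos θ))` of the heat semigroup on `ℤ`. -/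
noncomputable def heatWeight (t θ : ℝ) : ℝ := exp (-(t * (2 - 2 * cos θ)))

/-- `2π` times the heat kernel on `ℤ` at time `t`. -/
noncomputable def heatCoeff (t : ℝ) (n : ℤ) : ℝ :=
  ∫ θ in (-π)..π, cos (n * θ) * heatWeight t θ

/-- The constant in the Gaussian moment bound `integral_weighted_heatWeight_le`. -/
noncomputable def heatConst : ℝ := 15 ^ 3 * exp 4 * √(5 * π)

theorem heatConst_pos : 0 < heatConst := by
  unfold heatConst; positivity

theorem heatWeight_pos (t θ : ℝ) : 0 < heatWeight t θ := exp_pos _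

@[fun_prop]
theorem continuous_heatWeight (t : ℝ) : Continuous (heatWeight t) := by
  unfold heatWeight; fun_prop

theorem hasDerivAt_heatWeight (t θ : ℝ) :
    HasDerivAt (heatWeight t) (-(2 * t * sin θ) * heatWeight t θ) θ := by
  unfold heatWeight
  have h := ((((hasDerivAt_cos θ).const_mul 2).const_sub 2).const_mul t).neg.exp
  refine h.congr_deriv ?_
  simp only [Pi.neg_apply]
  ring

theorem weighted_heatWeight_le {t θ : ℝ} (ht : 0 ≤ t) (hθ : |θ| ≤ π) :
    (1 + (1 + t) * θ ^ 2) ^ 3 * heatWeight t θ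
      ≤ 15 ^ 3 * exp 4 * exp (-((1 + t) / 5) * θ ^ 2) := by
  have hpi : π ^ 2 ≤ 10 := by nlinarith [pi_pos, pi_lt_d2]
  have hsq : θ ^ 2 ≤ 10 := le_trans (sq_le_sq' (neg_le_of_abs_le hθ) (le_of_abs_le hθ)) hpi
  have hcos : 2 / 5 * θ ^ 2 ≤ 2 - 2 * cos θ := by
    have h := cos_le_one_sub_mul_cos_sq hθ
    have h' : (1 : ℝ) / 5 ≤ 2 / π ^ 2 := by
      rw [div_le_div_iff₀ (by norm_num) (by positivity)]; linarith
    nlinarith [sq_nonneg θ]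
  -- As `2/5 * θ² ≤ 4`, the factor `exp 4` pays for replacing `t` by `1 + t`.
  have hw : heatWeight t θ ≤ exp 4 * exp (-(2 / 5 * ((1 + t) * θ ^ 2))) := by
    rw [heatWeight, ← exp_add]
    apply exp_le_exp.2
    nlinarith [mul_le_mul_of_nonneg_left hcos ht]
  -- With `y = (1 + t) θ²`, the scale 15 makes the cube cost `exp (y / 5)`, half of the available
  -- decay `exp (-2y / 5)`.
  have hy : 1 + (1 + t) * θ ^ 2 ≤ 15 * exp ((1 + t) * θ ^ 2 / 15) := by
    have := add_one_le_exp ((1 + t) * θ ^ 2 / 15)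
    linarith
  calc (1 + (1 + t) * θ ^ 2) ^ 3 * heatWeight t θ
      ≤ (15 * exp ((1 + t) * θ ^ 2 / 15)) ^ 3 *
          (exp 4 * exp (-(2 / 5 * ((1 + t) * θ ^ 2)))) := by
        gcongr
        exact (heatWeight_pos t θ).le
    _ = 15 ^ 3 * exp 4 *
          (exp ((1 + t) * θ ^ 2 / 15) ^ 3 * exp (-(2 / 5 * ((1 + t) * θ ^ 2)))) := by ring
    _ = 15 ^ 3 * exp 4 * exp (-((1 + t) / 5) * θ ^ 2) := by
        rw [← exp_nat_mul, ← exp_add]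
        congr 2
        push_cast
        ring

theorem integral_weighted_heatWeight_le {t : ℝ} (ht : 0 ≤ t) :
    ∫ θ in (-π)..π, (1 + (1 + t) * θ ^ 2) ^ 3 * heatWeight t θ ≤ heatConst / √(1 + t) := by
  have hle : -π ≤ π := by linarith [pi_pos]
  have hint : Integrable
      fun θ : ℝ => 15 ^ 3 * exp 4 * exp (-((1 + t) / 5) * θ ^ 2) :=
    (integrable_exp_neg_mul_sq (by positivity)).const_mul _
  calc ∫ θ in (-π)..π, (1 + (1 + t) * θ ^ 2) ^ 3 * heatWeight t θ
      ≤ ∫ θ in (-π)..π, 15 ^ 3 * exp 4 * exp (-((1 + t) / 5) * θ ^ 2) := by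
        apply intervalIntegral.integral_mono_on hle
        · exact Continuous.intervalIntegrable (by fun_prop) _ _
        · exact hint.intervalIntegrable
        · exact fun θ hθ => weighted_heatWeight_le ht (abs_le.2 hθ)
    _ ≤ ∫ θ, 15 ^ 3 * exp 4 * exp (-((1 + t) / 5) * θ ^ 2) := by
        rw [intervalIntegral.integral_of_le hle]
        exact setIntegral_le_integral hint
          (Filter.Eventually.of_forall fun θ => by positivity)
    _ = heatConst / √(1 + t) := by
        rw [integral_const_mul, integral_gaussian, heatConst,
          show π / ((1 + t) / 5) = 5 * π / (1 + t) by field_simp, sqrt_div (by positivity)]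
        ring

/-- All kernel estimates reduce to this: on the natural scale `θ ~ (1 + t)^(-1/2)`, the polynomial
weight absorbs any growth of `f` in `θ`. -/
theorem abs_integral_mul_heatWeight_le {t A : ℝ} (ht : 0 ≤ t) {f : ℝ → ℝ}
    (hA : 0 ≤ A) (hfA : ∀ θ, |f θ| ≤ A * (1 + (1 + t) * θ ^ 2) ^ 3) :
    |∫ θ in (-π)..π, f θ * heatWeight t θ| ≤ A * heatConst / √(1 + t) := by
  have hle : -π ≤ π := by linarith [pi_pos]
  calc |∫ θ in (-π)..π, f θ * heatWeight t θ|
      ≤ ∫ θ in (-π)..π, A * ((1 + (1 + t) * θ ^ 2) ^ 3 * heatWeight t θ) := by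
        rw [← norm_eq_abs]
        apply intervalIntegral.norm_integral_le_of_norm_le hle
        · refine Filter.Eventually.of_forall fun θ _ => ?_
          rw [norm_mul, norm_eq_abs, norm_eq_abs, abs_of_pos (heatWeight_pos t θ), ← mul_assoc]
          exact mul_le_mul_of_nonneg_right (hfA θ) (heatWeight_pos t θ).le
        · exact Continuous.intervalIntegrable (by fun_prop) _ _
    _ ≤ A * heatConst / √(1 + t) := by
        rw [intervalIntegral.integral_const_mul, mul_div_assoc]
        exact mul_le_mul_of_nonneg_left (integral_weighted_heatWeight_le ht) hA

/-! ### Powers of `n` as symbols, by integration by parts. -/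

section IntegrationByParts

variable {g g' : ℝ → ℝ} (t : ℝ) (n : ℤ)

/-- Multiplication by `n` becomes the operator `L g = g' - 2 t sin θ g`. The boundary terms vanish
because `sin (n π) = 0`; in the companion with `sin`, they cancel by periodicity. -/
theorem mul_integral_cos_mul_heatWeight (hg : ∀ θ, HasDerivAt g (g' θ) θ) (hg' : Continuous g') :
    n * ∫ θ in (-π)..π, cos (n * θ) * g θ * heatWeight t θ
      = -∫ θ in (-π)..π, sin (n * θ) * (g' θ - 2 * t * sin θ * g θ) * heatWeight t θ := by
  have hgc : Continuous g := continuous_iff_continuousAt.2 fun θ => (hg θ).continuousAt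
  have hder : ∀ θ ∈ Set.uIcc (-π) π,
      HasDerivAt (fun θ => sin (n * θ) * g θ * heatWeight t θ)
        (n * (cos (n * θ) * g θ * heatWeight t θ) +
          sin (n * θ) * (g' θ - 2 * t * sin θ * g θ) * heatWeight t θ) θ := fun θ _ => by
    have h := ((((hasDerivAt_id θ).const_mul (n : ℝ)).sin).mul (hg θ)).mul
      (hasDerivAt_heatWeight t θ)
    refine h.congr_deriv ?_
    simp only [id, mul_one, Pi.mul_apply]
    ring
  have key := intervalIntegral.integral_eq_sub_of_hasDerivAt hder
    (Continuous.intervalIntegrable (by fun_prop) _ _)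
  rw [intervalIntegral.integral_add (Continuous.intervalIntegrable (by fun_prop) _ _)
    (Continuous.intervalIntegrable (by fun_prop) _ _), intervalIntegral.integral_const_mul,
    mul_neg, sin_neg, sin_int_mul_pi] at key
  simp only [zero_mul, neg_zero, sub_zero] at key
  linarith

theorem mul_integral_sin_mul_heatWeight (hg : ∀ θ, HasDerivAt g (g' θ) θ) (hg' : Continuous g')
    (hper : g (-π) = g π) :
    n * ∫ θ in (-π)..π, sin (n * θ) * g θ * heatWeight t θ
      = ∫ θ in (-π)..π, cos (n * θ) * (g' θ - 2 * t * sin θ * g θ) * heatWeight t θ := by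
  have hgc : Continuous g := continuous_iff_continuousAt.2 fun θ => (hg θ).continuousAt
  have hder : ∀ θ ∈ Set.uIcc (-π) π,
      HasDerivAt (fun θ => cos (n * θ) * g θ * heatWeight t θ)
        (-(n * (sin (n * θ) * g θ * heatWeight t θ)) +
          cos (n * θ) * (g' θ - 2 * t * sin θ * g θ) * heatWeight t θ) θ := fun θ _ => by
    have h := ((((hasDerivAt_id θ).const_mul (n : ℝ)).cos).mul (hg θ)).mul
      (hasDerivAt_heatWeight t θ)
    refine h.congr_deriv ?_
    simp only [id, mul_one, Pi.mul_apply]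
    ring
  have key := intervalIntegral.integral_eq_sub_of_hasDerivAt hder
    (Continuous.intervalIntegrable (by fun_prop) _ _)
  have hw : heatWeight t (-π) = heatWeight t π := by simp [heatWeight]
  rw [intervalIntegral.integral_add (Continuous.intervalIntegrable (by fun_prop) _ _)
    (Continuous.intervalIntegrable (by fun_prop) _ _), intervalIntegral.integral_neg,
    intervalIntegral.integral_const_mul, mul_neg, cos_neg, hper, hw, sub_self] at key
  linarith

end IntegrationByParts

/-- The symbol of `n³ ·` acting on the heat kernel. -/
noncomputable def cubicSymbol (t θ : ℝ) : ℝ :=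
  2 * t * sin θ + 12 * t ^ 2 * (sin θ * cos θ) - 8 * t ^ 3 * sin θ ^ 3

/-- The symbol of `n⁴ ·` acting on the heat kernel. -/
noncomputable def quarticSymbol (t θ : ℝ) : ℝ :=
  2 * t * cos θ + 12 * t ^ 2 * cos θ ^ 2 - 16 * t ^ 2 * sin θ ^ 2
    - 48 * t ^ 3 * (sin θ ^ 2 * cos θ) + 16 * t ^ 4 * sin θ ^ 4

/-- The symbol is `L³ 1`, up to signs that cancel over the three steps; one more step gives the
quartic symbol `L⁴ 1`. -/
theorem pow_three_mul_heatCoeff (t : ℝ) (n : ℤ) :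
    (n : ℝ) ^ 3 * heatCoeff t n
      = ∫ θ in (-π)..π, sin (n * θ) * cubicSymbol t θ * heatWeight t θ := by
  have h1 := mul_integral_cos_mul_heatWeight (g := fun _ => 1) (g' := fun _ => 0) t n
    (fun θ => hasDerivAt_const θ 1) (by fun_prop)
  have h2 := mul_integral_sin_mul_heatWeight (g := fun θ => -(2 * t * sin θ))
    (g' := fun θ => -(2 * t * cos θ)) t n
    (fun θ => ((hasDerivAt_sin θ).const_mul (2 * t)).neg) (by fun_prop) (by simp)
  have h3 := mul_integral_cos_mul_heatWeight
    (g := fun θ => -(2 * t * cos θ) + 4 * t ^ 2 * sin θ ^ 2)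
    (g' := fun θ => 2 * t * sin θ + 8 * t ^ 2 * (sin θ * cos θ)) t n
    (fun θ => ((((hasDerivAt_cos θ).const_mul (2 * t)).neg).add
      (((hasDerivAt_sin θ).pow 2).const_mul (4 * t ^ 2))).congr_deriv (by simp; ring))
    (by fun_prop)
  have e1 : ∫ θ in (-π)..π, cos (n * θ) * 1 * heatWeight t θ = heatCoeff t n := by
    simp [heatCoeff]
  have e2 : ∫ θ in (-π)..π, sin (n * θ) * (0 - 2 * t * sin θ * 1) * heatWeight t θ
      = ∫ θ in (-π)..π, sin (n * θ) * -(2 * t * sin θ) * heatWeight t θ := by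
    congr 1; ext θ; ring
  have e3 : ∫ θ in (-π)..π, cos (n * θ) * (-(2 * t * cos θ) - 2 * t * sin θ * -(2 * t * sin θ))
        * heatWeight t θ
      = ∫ θ in (-π)..π, cos (n * θ) * (-(2 * t * cos θ) + 4 * t ^ 2 * sin θ ^ 2)
        * heatWeight t θ := by
    congr 1; ext θ; ring
  have e4 : ∫ θ in (-π)..π, sin (n * θ) * (2 * t * sin θ + 8 * t ^ 2 * (sin θ * cos θ)
        - 2 * t * sin θ * (-(2 * t * cos θ) + 4 * t ^ 2 * sin θ ^ 2)) * heatWeight t θ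
      = ∫ θ in (-π)..π, sin (n * θ) * cubicSymbol t θ * heatWeight t θ := by
    congr 1; ext θ; unfold cubicSymbol; ring
  rw [e1, e2] at h1
  rw [e3] at h2
  rw [e4] at h3
  linear_combination (n : ℝ) ^ 2 * h1 - (n : ℝ) * h2 - h3

theorem pow_four_mul_heatCoeff (t : ℝ) (n : ℤ) :
    (n : ℝ) ^ 4 * heatCoeff t n
      = ∫ θ in (-π)..π, cos (n * θ) * quarticSymbol t θ * heatWeight t θ := by
  have h := mul_integral_sin_mul_heatWeight (g := cubicSymbol t)
    (g' := fun θ => 2 * t * cos θ + 12 * t ^ 2 * (cos θ ^ 2 - sin θ ^ 2)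
      - 24 * t ^ 3 * (sin θ ^ 2 * cos θ)) t n
    (fun θ => ((((hasDerivAt_sin θ).const_mul (2 * t)).add
      (((hasDerivAt_sin θ).mul (hasDerivAt_cos θ)).const_mul (12 * t ^ 2))).sub
      (((hasDerivAt_sin θ).pow 3).const_mul (8 * t ^ 3))).congr_deriv (by simp; ring))
    (by fun_prop) (by simp [cubicSymbol])
  rw [← pow_three_mul_heatCoeff] at h
  rw [pow_succ', mul_assoc, h]
  congr 1; ext θ; unfold cubicSymbol quarticSymbol; ring

/-! ### Decay of the one-dimensional heat kernel and its differences. -/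

theorem abs_heatCoeff_le {t : ℝ} (ht : 0 ≤ t) (n : ℤ) :
    |heatCoeff t n| ≤ heatConst / √(1 + t) := by
  have h := abs_integral_mul_heatWeight_le (A := 1) (f := fun θ => cos (n * θ)) ht zero_le_one
    fun θ => by
      rw [one_mul]
      exact (abs_cos_le_one _).trans (one_le_pow₀ (by nlinarith [sq_nonneg θ]))
  simpa only [heatCoeff, one_mul] using h

/-- In the variables `u = √(1 + t)` and `y = u |θ|`, every term is at most `u³` times a polynomial
in `y`; 22 is the sum of the coefficients. -/
theorem abs_cubicSymbol_le {t : ℝ} (ht : 0 ≤ t) (θ : ℝ) :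
    |cubicSymbol t θ| ≤ 22 * √(1 + t) ^ 3 * (1 + (1 + t) * θ ^ 2) ^ 3 := by
  have hsq : √(1 + t) ^ 2 = 1 + t := sq_sqrt (by positivity)
  have hu1 : 1 ≤ √(1 + t) := one_le_sqrt.2 (by linarith)
  have hS : |sin θ| ≤ |θ| := abs_sin_le_abs
  have hC := abs_cos_le_one θ
  rw [show (1 + t) * θ ^ 2 = (√(1 + t) * |θ|) ^ 2 by rw [mul_pow, hsq, sq_abs]]
  generalize √(1 + t) = u at *
  have htu : t ≤ u ^ 2 := by linarith
  have ha : 0 ≤ |θ| := abs_nonneg θ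
  have hsum : |cubicSymbol t θ|
      ≤ 2 * t * |sin θ| + 12 * t ^ 2 * (|sin θ| * |cos θ|) + 8 * t ^ 3 * |sin θ| ^ 3 := by
    unfold cubicSymbol
    refine (abs_sub _ _).trans (add_le_add ((abs_add_le _ _).trans (add_le_add ?_ ?_)) ?_) <;>
      simp [abs_mul, abs_of_nonneg ht]
  have h2 : u ^ 2 * |θ| ≤ u ^ 4 * |θ| :=
    mul_le_mul_of_nonneg_right (pow_le_pow_right₀ hu1 (by norm_num)) ha
  set y := u * |θ| with hy
  have hy0 : 0 ≤ y := by positivity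
  have hu0 : 0 ≤ u ^ 3 := by positivity
  calc |cubicSymbol t θ|
      ≤ 2 * u ^ 2 * |θ| + 12 * (u ^ 2) ^ 2 * (|θ| * 1) + 8 * (u ^ 2) ^ 3 * |θ| ^ 3 := by
        refine hsum.trans ?_
        gcongr
    _ ≤ u ^ 3 * (14 * y + 8 * y ^ 3) := by
        rw [hy]; linarith
    _ ≤ u ^ 3 * (22 * (1 + y ^ 2) ^ 3) := by
        gcongr
        nlinarith [sq_nonneg (y - 1), sq_nonneg (y ^ 2 - y), pow_nonneg hy0 4, pow_nonneg hy0 6]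
    _ = 22 * u ^ 3 * (1 + y ^ 2) ^ 3 := by ring

/-- The weight has exponent 2, not 3: the spare factor later absorbs the `|θ|` coming from a
difference of cosines. -/
theorem abs_quarticSymbol_le {t : ℝ} (ht : 0 ≤ t) (θ : ℝ) :
    |quarticSymbol t θ| ≤ 94 * √(1 + t) ^ 4 * (1 + (1 + t) * θ ^ 2) ^ 2 := by
  have hsq : √(1 + t) ^ 2 = 1 + t := sq_sqrt (by positivity)
  have hu1 : 1 ≤ √(1 + t) := one_le_sqrt.2 (by linarith)
  have hS : |sin θ| ≤ |θ| := abs_sin_le_abs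
  have hS1 := abs_sin_le_one θ
  have hC := abs_cos_le_one θ
  rw [show (1 + t) * θ ^ 2 = (√(1 + t) * |θ|) ^ 2 by rw [mul_pow, hsq, sq_abs]]
  generalize √(1 + t) = u at *
  have htu : t ≤ u ^ 2 := by linarith
  have hsum : |quarticSymbol t θ|
      ≤ 2 * t * |cos θ| + 12 * t ^ 2 * |cos θ| ^ 2 + 16 * t ^ 2 * |sin θ| ^ 2
        + 48 * t ^ 3 * (|sin θ| ^ 2 * |cos θ|) + 16 * t ^ 4 * |sin θ| ^ 4 := by
    unfold quarticSymbol
    refine (abs_add_le _ _).trans (add_le_add ((abs_sub _ _).trans (add_le_add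
      ((abs_sub _ _).trans (add_le_add ((abs_add_le _ _).trans (add_le_add ?_ ?_)) ?_)) ?_)) ?_) <;>
      simp [abs_mul, abs_of_nonneg ht]
  have h2 : u ^ 2 ≤ u ^ 4 := pow_le_pow_right₀ hu1 (by norm_num)
  set y := u * |θ| with hy
  have hy0 : 0 ≤ y := by positivity
  calc |quarticSymbol t θ|
      ≤ 2 * u ^ 2 * 1 + 12 * (u ^ 2) ^ 2 * 1 ^ 2 + 16 * (u ^ 2) ^ 2 * 1 ^ 2
        + 48 * (u ^ 2) ^ 3 * (|θ| ^ 2 * 1) + 16 * (u ^ 2) ^ 4 * |θ| ^ 4 := by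
        refine hsum.trans ?_
        gcongr
    _ ≤ u ^ 4 * (30 + 48 * y ^ 2 + 16 * y ^ 4) := by
        rw [hy]; linarith
    _ ≤ u ^ 4 * (94 * (1 + y ^ 2) ^ 2) := by
        gcongr
        nlinarith [sq_nonneg y, pow_nonneg hy0 4]
    _ = 94 * u ^ 4 * (1 + y ^ 2) ^ 2 := by ring

theorem sqrt_mul_abs_le {t : ℝ} (ht : 0 ≤ t) (θ : ℝ) :
    √(1 + t) * |θ| ≤ 1 + (1 + t) * θ ^ 2 := by
  have h : (√(1 + t) * |θ|) ^ 2 = (1 + t) * θ ^ 2 := by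
    rw [mul_pow, sq_sqrt (by positivity), sq_abs]
  nlinarith [sq_nonneg (√(1 + t) * |θ| - 1)]

theorem one_le_sqrt_one_add {t : ℝ} (ht : 0 ≤ t) : 1 ≤ √(1 + t) :=
  one_le_sqrt.2 (by linarith)

theorem pow_three_mul_abs_heatCoeff_le {t : ℝ} (ht : 0 ≤ t) (n : ℤ) :
    |(n : ℝ)| ^ 3 * |heatCoeff t n| ≤ 22 * heatConst * √(1 + t) ^ 2 := by
  have hu := one_le_sqrt_one_add ht
  have h := abs_integral_mul_heatWeight_le (A := 22 * √(1 + t) ^ 3)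
    (f := fun θ => sin (n * θ) * cubicSymbol t θ) ht (by positivity) fun θ => by
      rw [abs_mul]
      exact (mul_le_of_le_one_left (abs_nonneg _) (abs_sin_le_one _)).trans
        (abs_cubicSymbol_le ht θ)
  rw [← pow_three_mul_heatCoeff, abs_mul, abs_pow] at h
  refine h.trans_eq ?_
  field_simp

theorem pow_four_mul_abs_heatCoeff_le {t : ℝ} (ht : 0 ≤ t) (n : ℤ) :
    (n : ℝ) ^ 4 * |heatCoeff t n| ≤ 94 * heatConst * √(1 + t) ^ 3 := by
  have hu := one_le_sqrt_one_add ht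
  have h := abs_integral_mul_heatWeight_le (A := 94 * √(1 + t) ^ 4)
    (f := fun θ => cos (n * θ) * quarticSymbol t θ) ht (by positivity) fun θ => by
      rw [abs_mul]
      refine (mul_le_of_le_one_left (abs_nonneg _) (abs_cos_le_one _)).trans
        ((abs_quarticSymbol_le ht θ).trans ?_)
      gcongr
      · nlinarith [sq_nonneg θ]
      · norm_num
  rw [← pow_four_mul_heatCoeff, abs_mul, abs_of_nonneg (by positivity : (0 : ℝ) ≤ n ^ 4)] at h
  refine h.trans_eq ?_
  field_simp

theorem abs_cos_int_mul_sub_le {n n' : ℤ} (h : |n - n'| = 1) (θ : ℝ) :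
    |cos (n * θ) - cos (n' * θ)| ≤ |θ| := by
  have h1 : |(n : ℝ) - n'| = 1 := by exact_mod_cast h
  refine (abs_cos_sub_cos_le _ _).trans_eq ?_
  rw [← sub_mul, abs_mul, h1, one_mul]

theorem abs_heatCoeff_sub_le {t : ℝ} (ht : 0 ≤ t) {n n' : ℤ} (h : |n - n'| = 1) :
    |heatCoeff t n - heatCoeff t n'| ≤ heatConst / √(1 + t) ^ 2 := by
  have hu := one_le_sqrt_one_add ht
  have key := abs_integral_mul_heatWeight_le (A := 1 / √(1 + t))
    (f := fun θ => cos (n * θ) - cos (n' * θ)) ht (by positivity) fun θ => by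
      refine (abs_cos_int_mul_sub_le h θ).trans ?_
      rw [div_mul_eq_mul_div, le_div_iff₀ (by positivity), one_mul, mul_comm]
      exact (sqrt_mul_abs_le ht θ).trans
        (le_self_pow₀ (by nlinarith [sq_nonneg θ]) (by norm_num))
  simp only [sub_mul] at key
  rw [intervalIntegral.integral_sub (Continuous.intervalIntegrable (by fun_prop) _ _)
    (Continuous.intervalIntegrable (by fun_prop) _ _)] at key
  refine key.trans_eq ?_
  field_simp

theorem abs_pow_four_sub_pow_four_le {n n' : ℤ} (h : |n - n'| = 1) :
    |(n : ℝ) ^ 4 - (n' : ℝ) ^ 4| ≤ 15 * |(n' : ℝ)| ^ 3 + 1 := by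
  have hz : |n ^ 4 - n' ^ 4| ≤ 15 * |n'| ^ 3 + 1 := by
    have h1 : |n'| ≤ |n'| ^ 3 := by
      rcases eq_or_ne n' 0 with rfl | hn
      · simp
      · exact le_self_pow₀ (Int.one_le_abs hn) (by norm_num)
    have h2 : |n'| ^ 2 ≤ |n'| ^ 3 := by
      rcases eq_or_ne n' 0 with rfl | hn
      · simp
      · exact pow_le_pow_right₀ (Int.one_le_abs hn) (by norm_num)
    have h3 : |n' ^ 3| = |n'| ^ 3 := abs_pow _ _
    have h4 := sq_abs n'
    rcases (abs_eq (zero_le_one (α := ℤ))).1 h with h | h <;>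
      rw [sub_eq_iff_eq_add] at h <;> subst h <;> rw [abs_le] <;> constructor <;>
      linarith [sq_nonneg n', le_abs_self n', neg_abs_le n', le_abs_self (n' ^ 3), neg_abs_le (n' ^ 3)]
  exact_mod_cast hz

/-- A discrete Leibniz rule: the difference of `n⁴ * heatCoeff t n` is controlled by the quartic
symbol, and the commutator `n⁴ - n'⁴` by the cubic moment. The constant is `425 = 94 + (15 * 22 +
1)`. -/
theorem pow_four_mul_abs_heatCoeff_sub_le {t : ℝ} (ht : 0 ≤ t) {n n' : ℤ} (h : |n - n'| = 1) :
    (n : ℝ) ^ 4 * |heatCoeff t n - heatCoeff t n'| ≤ 425 * heatConst * √(1 + t) ^ 2 := by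
  have hu := one_le_sqrt_one_add ht
  have hC := heatConst_pos
  have key := abs_integral_mul_heatWeight_le (A := 94 * √(1 + t) ^ 3)
    (f := fun θ => (cos (n * θ) - cos (n' * θ)) * quarticSymbol t θ) ht (by positivity)
    fun θ => by
      rw [abs_mul]
      have h1 : (√(1 + t) * |θ|) * |quarticSymbol t θ|
          ≤ (1 + (1 + t) * θ ^ 2) * (94 * √(1 + t) ^ 4 * (1 + (1 + t) * θ ^ 2) ^ 2) :=
        mul_le_mul (sqrt_mul_abs_le ht θ) (abs_quarticSymbol_le ht θ) (abs_nonneg _)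
          (by positivity)
      have h2 := mul_le_mul_of_nonneg_right (abs_cos_int_mul_sub_le h θ)
        (abs_nonneg (quarticSymbol t θ))
      refine h2.trans (le_of_mul_le_mul_left (a := √(1 + t)) ?_ (by positivity))
      linarith
  simp only [sub_mul] at key
  have hq : Continuous (quarticSymbol t) := by unfold quarticSymbol; fun_prop
  rw [intervalIntegral.integral_sub (Continuous.intervalIntegrable (by fun_prop) _ _)
    (Continuous.intervalIntegrable (by fun_prop) _ _), ← pow_four_mul_heatCoeff,
    ← pow_four_mul_heatCoeff] at key
  have h3 := pow_three_mul_abs_heatCoeff_le ht n'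
  have h0 : |heatCoeff t n'| ≤ heatConst * √(1 + t) ^ 2 :=
    (abs_heatCoeff_le ht n').trans ((div_le_self hC.le hu).trans
      (le_mul_of_one_le_right hC.le (one_le_pow₀ hu)))
  have hd : |((n : ℝ) ^ 4 - (n' : ℝ) ^ 4) * heatCoeff t n'|
      ≤ 331 * heatConst * √(1 + t) ^ 2 := by
    rw [abs_mul]
    refine (mul_le_mul_of_nonneg_right (abs_pow_four_sub_pow_four_le h) (abs_nonneg _)).trans ?_
    linarith
  have e : 94 * √(1 + t) ^ 3 * heatConst / √(1 + t) = 94 * heatConst * √(1 + t) ^ 2 := by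
    field_simp
  rw [e] at key
  calc (n : ℝ) ^ 4 * |heatCoeff t n - heatCoeff t n'|
      = |((n : ℝ) ^ 4 * heatCoeff t n - (n' : ℝ) ^ 4 * heatCoeff t n')
          - ((n : ℝ) ^ 4 - (n' : ℝ) ^ 4) * heatCoeff t n'| := by
        rw [← abs_of_nonneg (by positivity : (0 : ℝ) ≤ n ^ 4), ← abs_mul,
          abs_of_nonneg (by positivity : (0 : ℝ) ≤ n ^ 4)]
        congr 1; ring
    _ ≤ _ := (abs_sub _ _).trans (by linarith)

/-! ### Space-time decay of the three-dimensional heat kernel gradient. -/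

/-- Multiplying the product by each of `u⁴, a⁴, b⁴, c⁴`, where `u² = 1 + t`, leaves a bounded
quantity. Cauchy–Schwarz recombines the four bounds: `2456 = 4 * (1 + 425 + 94 + 94)`. -/
theorem heatCoeff_triple_sub_le {t : ℝ} (ht : 0 ≤ t) {a a' : ℤ} (h : |a - a'| = 1) (b c : ℤ) :
    |heatCoeff t a - heatCoeff t a'| * |heatCoeff t b| * |heatCoeff t c|
      ≤ 2456 * heatConst ^ 3 / (1 + t + ((a : ℝ) ^ 2 + (b : ℝ) ^ 2 + (c : ℝ) ^ 2)) ^ 2 := by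
  have hu := one_le_sqrt_one_add ht
  have hK := heatConst_pos
  have hd := abs_heatCoeff_sub_le ht h
  have hd4 := pow_four_mul_abs_heatCoeff_sub_le ht h
  have hb := abs_heatCoeff_le ht b
  have hc := abs_heatCoeff_le ht c
  have hb4 := pow_four_mul_abs_heatCoeff_le ht b
  have hc4 := pow_four_mul_abs_heatCoeff_le ht c
  have hsq : √(1 + t) ^ 2 = 1 + t := sq_sqrt (by positivity)
  rw [← hsq]
  generalize √(1 + t) = u at *
  have hu0 : 0 < u := by linarith
  have hd0 := abs_nonneg (heatCoeff t a - heatCoeff t a')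
  have hb0 := abs_nonneg (heatCoeff t b)
  have hc0 := abs_nonneg (heatCoeff t c)
  generalize |heatCoeff t a - heatCoeff t a'| = d at *
  generalize |heatCoeff t b| = β at *
  generalize |heatCoeff t c| = γ at *
  have k0 : u ^ 4 * (d * β * γ) ≤ heatConst ^ 3 := by
    calc u ^ 4 * (d * β * γ)
        ≤ u ^ 4 * (heatConst / u ^ 2 * (heatConst / u) * (heatConst / u)) := by gcongr
      _ = heatConst ^ 3 := by field_simp
  have k1 : (a : ℝ) ^ 4 * (d * β * γ) ≤ 425 * heatConst ^ 3 := by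
    calc (a : ℝ) ^ 4 * (d * β * γ) = a ^ 4 * d * β * γ := by ring
      _ ≤ 425 * heatConst * u ^ 2 * (heatConst / u) * (heatConst / u) := by gcongr
      _ = 425 * heatConst ^ 3 := by field_simp
  have k2 : (b : ℝ) ^ 4 * (d * β * γ) ≤ 94 * heatConst ^ 3 := by
    calc (b : ℝ) ^ 4 * (d * β * γ) = b ^ 4 * β * d * γ := by ring
      _ ≤ 94 * heatConst * u ^ 3 * (heatConst / u ^ 2) * (heatConst / u) := by gcongr
      _ = 94 * heatConst ^ 3 := by field_simp
  have k3 : (c : ℝ) ^ 4 * (d * β * γ) ≤ 94 * heatConst ^ 3 := by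
    calc (c : ℝ) ^ 4 * (d * β * γ) = c ^ 4 * γ * d * β := by ring
      _ ≤ 94 * heatConst * u ^ 3 * (heatConst / u ^ 2) * (heatConst / u) := by gcongr
      _ = 94 * heatConst ^ 3 := by field_simp
  have hcs : (u ^ 2 + ((a : ℝ) ^ 2 + (b : ℝ) ^ 2 + (c : ℝ) ^ 2)) ^ 2
      ≤ 4 * (u ^ 4 + a ^ 4 + b ^ 4 + c ^ 4) := by
    nlinarith [sq_nonneg (u ^ 2 - (a : ℝ) ^ 2), sq_nonneg (u ^ 2 - (b : ℝ) ^ 2),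
      sq_nonneg (u ^ 2 - (c : ℝ) ^ 2), sq_nonneg ((a : ℝ) ^ 2 - (b : ℝ) ^ 2),
      sq_nonneg ((a : ℝ) ^ 2 - (c : ℝ) ^ 2), sq_nonneg ((b : ℝ) ^ 2 - (c : ℝ) ^ 2)]
  rw [le_div_iff₀ (by positivity), mul_comm]
  refine (mul_le_mul_of_nonneg_right hcs (by positivity)).trans ?_
  linarith

theorem lattice_adj_cases {x y : Fin 3 → ℤ} (h : lattice.Adj x y) :
    (|x 0 - y 0| = 1 ∧ y 1 = x 1 ∧ y 2 = x 2) ∨ (|x 1 - y 1| = 1 ∧ y 0 = x 0 ∧ y 2 = x 2) ∨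
      (|x 2 - y 2| = 1 ∧ y 0 = x 0 ∧ y 1 = x 1) := by
  have h' : ∑ i, |x i - y i| = 1 := h
  rw [Fin.sum_univ_three] at h'
  rcases abs_cases (x 0 - y 0) with h0 | h0 <;> rcases abs_cases (x 1 - y 1) with h1 | h1 <;>
    rcases abs_cases (x 2 - y 2) with h2 | h2 <;> omega

theorem abs_prod_heatCoeff_sub_le {t : ℝ} (ht : 0 ≤ t) {x y : Fin 3 → ℤ} (h : lattice.Adj x y) :
    |∏ i, heatCoeff t (x i) - ∏ i, heatCoeff t (y i)|
      ≤ 2456 * heatConst ^ 3 / (1 + t + ∑ i, (x i : ℝ) ^ 2) ^ 2 := by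
  simp only [Fin.prod_univ_three, Fin.sum_univ_three]
  rcases lattice_adj_cases h with ⟨h, h1, h2⟩ | ⟨h, h1, h2⟩ | ⟨h, h1, h2⟩ <;> rw [h1, h2]
  · refine Eq.trans_le ?_ (heatCoeff_triple_sub_le ht h (x 1) (x 2))
    rw [← abs_mul, ← abs_mul]
    congr 1; ring
  · refine Eq.trans_le ?_ ((heatCoeff_triple_sub_le ht h (x 0) (x 2)).trans_eq ?_)
    · rw [← abs_mul, ← abs_mul]
      congr 1; ring
    · congr 3; ring
  · refine Eq.trans_le ?_ ((heatCoeff_triple_sub_le ht h (x 0) (x 1)).trans_eq ?_)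
    · rw [← abs_mul, ← abs_mul]
      congr 1; ring
    · congr 3; ring

/-! ### The Green's function as a time integral of heat kernels. -/

/-- The Brillouin zone `[-π, π]³`. -/
def brillouinZone : Set (Fin 3 → ℝ) := univ.pi fun _ => Icc (-π) π

theorem volume_restrict_brillouinZone :
    (volume : Measure (Fin 3 → ℝ)).restrict brillouinZone
      = Measure.pi fun _ => (volume : Measure ℝ).restrict (Icc (-π) π) := by
  rw [brillouinZone, volume_pi, Measure.restrict_pi_pi]

instance : IsFiniteMeasure ((volume : Measure (Fin 3 → ℝ)).restrict brillouinZone) := by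
  rw [volume_restrict_brillouinZone]
  infer_instance

theorem setIntegral_prod_heatWeight (t : ℝ) (x : Fin 3 → ℤ) :
    ∫ θ in brillouinZone, ∏ i, (cos (x i * θ i) * heatWeight t (θ i))
      = ∏ i, heatCoeff t (x i) := by
  rw [volume_restrict_brillouinZone, integral_fintype_prod_eq_prod
    (f := fun i θ => cos (x i * θ) * heatWeight t θ)]
  refine Finset.prod_congr rfl fun i _ => ?_
  rw [heatCoeff, intervalIntegral.integral_of_le (by linarith [pi_pos]),
    integral_Icc_eq_integral_Ioc]

theorem isCompact_brillouinZone : IsCompact brillouinZone :=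
  isCompact_univ_pi fun _ => isCompact_Icc

theorem integrableOn_sqrt_one_add_pow_three :
    IntegrableOn (fun t : ℝ => (heatConst / √(1 + t)) ^ 3) (Ioi 0) := by
  have h := (integrableOn_add_rpow_Ioi_of_lt (a := -(3 / 2)) (c := 0) (m := 1)
    (by norm_num) (by norm_num)).const_mul (heatConst ^ 3)
  refine IntegrableOn.congr_fun h (fun t ht => ?_) measurableSet_Ioi
  have ht0 : (0 : ℝ) < t := ht
  have hp : (0 : ℝ) < 1 + t := by linarith
  have e : (1 + t) ^ (3 / 2 : ℝ) = √(1 + t) ^ 3 := by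
    rw [sqrt_eq_rpow, ← rpow_natCast, ← rpow_mul hp.le]
    norm_num
  rw [div_pow, add_comm t 1, rpow_neg hp.le, e, div_eq_mul_inv]

/-- Dimension three enters here: integrating in `θ` first leaves `O((1 + t)^(-3/2))`, which is
integrable in time. This justifies Fubini even for `σ = 0`. -/
theorem integrable_prod_heatWeight :
    Integrable (fun p : (Fin 3 → ℝ) × ℝ => ∏ i, heatWeight p.2 (p.1 i))
      ((volume.restrict brillouinZone).prod (volume.restrict (Ioi 0))) := by
  have hcont : Continuous fun p : (Fin 3 → ℝ) × ℝ => ∏ i, heatWeight p.2 (p.1 i) := by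
    unfold heatWeight; fun_prop
  have hmeas := hcont.aestronglyMeasurable
    (μ := ((volume.restrict brillouinZone).prod (volume.restrict (Ioi (0 : ℝ)))))
  refine (integrable_prod_iff' hmeas).2 ⟨Filter.Eventually.of_forall fun t => ?_, ?_⟩
  · have hc : Continuous fun θ : Fin 3 → ℝ => ∏ i, heatWeight t (θ i) := by fun_prop
    exact hc.continuousOn.integrableOn_compact isCompact_brillouinZone
  · refine integrableOn_sqrt_one_add_pow_three.mono' hmeas.prod_swap.norm.integral_prod_right' ?_
    refine (ae_restrict_iff' measurableSet_Ioi).2 (Filter.Eventually.of_forall fun t ht => ?_)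
    have h := setIntegral_prod_heatWeight t 0
    simp only [Pi.zero_apply, Int.cast_zero, zero_mul, cos_zero, one_mul, Finset.prod_const,
      Finset.card_univ, Fintype.card_fin] at h
    have e : ∀ θ : Fin 3 → ℝ, ‖∏ i, heatWeight t (θ i)‖ = ∏ i, heatWeight t (θ i) := fun θ =>
      norm_of_nonneg (Finset.prod_nonneg fun i _ => (heatWeight_pos _ _).le)
    simp only [e, h, norm_pow]
    exact pow_le_pow_left₀ (norm_nonneg _) (abs_heatCoeff_le (le_of_lt ht) 0) 3

/-- The space-time integrand whose time integral is the integrand of `latticeGreen`. -/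
noncomputable def heatIntegrand (σ : ℝ) (x : Fin 3 → ℤ) (θ : Fin 3 → ℝ) (t : ℝ) : ℝ :=
  exp (-σ * t) * ∏ i, (cos (x i * θ i) * heatWeight t (θ i))

theorem integrable_heatIntegrand {σ : ℝ} (hσ : 0 ≤ σ) (x : Fin 3 → ℤ) :
    Integrable (Function.uncurry (heatIntegrand σ x))
      ((volume.restrict brillouinZone).prod (volume.restrict (Ioi 0))) := by
  have hcont : Continuous (Function.uncurry (heatIntegrand σ x)) := by
    unfold Function.uncurry heatIntegrand heatWeight; fun_prop
  refine integrable_prod_heatWeight.mono' hcont.aestronglyMeasurable ?_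
  rw [Measure.prod_restrict]
  refine (ae_restrict_iff' ?_).2 (Filter.Eventually.of_forall fun p hp => ?_)
  · exact isCompact_brillouinZone.measurableSet.prod measurableSet_Ioi
  have ht : 0 < p.2 := hp.2
  have hexp : exp (-σ * p.2) ≤ 1 := exp_le_one_iff.2 (by nlinarith)
  rw [Function.uncurry, heatIntegrand, norm_mul, norm_prod, norm_of_nonneg (exp_pos _).le]
  refine (mul_le_of_le_one_left (Finset.prod_nonneg fun i _ => norm_nonneg _) hexp).trans ?_
  refine Finset.prod_le_prod (fun i _ => norm_nonneg _) fun i _ => ?_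
  rw [norm_mul, norm_of_nonneg (heatWeight_pos _ _).le]
  exact mul_le_of_le_one_left (heatWeight_pos _ _).le (abs_cos_le_one _)

theorem setIntegral_exp_neg_mul {s : ℝ} (hs : 0 ≤ s) : ∫ t in Ioi (0 : ℝ), exp (-s * t) = 1 / s := by
  rcases hs.eq_or_lt with rfl | hs
  -- At `s = 0` the integral diverges, so both sides take the default value 0; the identity thus
  -- also covers the singular point `θ = 0`, `σ = 0`.
  · simp [Measure.real]
  · rw [integral_exp_mul_Ioi (by linarith)]
    simp

theorem integral_heatIntegrand {σ : ℝ} (hσ : 0 ≤ σ) (x : Fin 3 → ℤ) (θ : Fin 3 → ℝ) :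
    ∫ t in Ioi 0, heatIntegrand σ x θ t
      = (∏ i, cos (x i * θ i)) / (6 + σ - 2 * ∑ i, cos (θ i)) := by
  have hs : 0 ≤ 6 + σ - 2 * ∑ i, cos (θ i) := by
    rw [Fin.sum_univ_three]
    linarith [cos_le_one (θ 0), cos_le_one (θ 1), cos_le_one (θ 2)]
  rw [div_eq_mul_one_div, ← setIntegral_exp_neg_mul hs, ← integral_const_mul]
  congr 1; ext t
  rw [heatIntegrand, Finset.prod_mul_distrib, mul_left_comm]
  congr 1
  simp only [heatWeight, ← exp_sum, ← exp_add, Fin.sum_univ_three]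
  congr 1; ring

theorem latticeGreen_eq_integral {σ : ℝ} (hσ : 0 ≤ σ) (x : Fin 3 → ℤ) :
    latticeGreen σ x
      = 1 / (2 * π) ^ 3 * ∫ t in Ioi 0, exp (-σ * t) * ∏ i, heatCoeff t (x i) := by
  have h := integral_integral_swap (integrable_heatIntegrand hσ x)
  simp only [integral_heatIntegrand hσ] at h
  rw [latticeGreen]
  refine congrArg _ (h.trans ?_)
  congr 1; ext t
  simp only [heatIntegrand]
  rw [integral_const_mul, setIntegral_prod_heatWeight]

theorem integrableOn_exp_mul_prod_heatCoeff {σ : ℝ} (hσ : 0 ≤ σ) (x : Fin 3 → ℤ) :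
    IntegrableOn (fun t => exp (-σ * t) * ∏ i, heatCoeff t (x i)) (Ioi 0) := by
  refine (integrable_heatIntegrand hσ x).integral_prod_right.congr
    (Filter.Eventually.of_forall fun t => ?_)
  simp only [Function.uncurry, heatIntegrand]
  rw [integral_const_mul, setIntegral_prod_heatWeight]

/-! ### Time integration and the gradient bound for the Green's function. -/

theorem hasDerivAt_neg_one_div_add {r t : ℝ} (h : 1 + t + r ≠ 0) :
    HasDerivAt (fun t : ℝ => -(1 / (1 + t + r))) (1 / (1 + t + r) ^ 2) t := by
  have := ((((hasDerivAt_id t).const_add 1).add_const r).inv h).neg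
  simp only [id, neg_div, neg_neg] at this
  simpa only [one_div] using! this.congr_deriv (by simp)

theorem tendsto_neg_one_div_add (r : ℝ) :
    Filter.Tendsto (fun t : ℝ => -(1 / (1 + t + r))) Filter.atTop (nhds 0) := by
  have h : Filter.Tendsto (fun t : ℝ => 1 + t + r) Filter.atTop Filter.atTop :=
    Filter.tendsto_atTop_add_const_right _ _ (Filter.tendsto_atTop_add_const_left _ _
      Filter.tendsto_id)
  simpa using h.inv_tendsto_atTop.neg

theorem integrableOn_one_div_add_sq {r : ℝ} (hr : 0 ≤ r) :
    IntegrableOn (fun t : ℝ => 1 / (1 + t + r) ^ 2) (Ioi 0) :=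
  integrableOn_Ioi_deriv_of_nonneg'
    (fun t (ht : 0 ≤ t) => hasDerivAt_neg_one_div_add (by positivity))
    (fun t _ => by positivity) (tendsto_neg_one_div_add r)

theorem integral_one_div_add_sq {r : ℝ} (hr : 0 ≤ r) :
    ∫ t in Ioi (0 : ℝ), 1 / (1 + t + r) ^ 2 = 1 / (1 + r) := by
  rw [integral_Ioi_of_hasDerivAt_of_tendsto'
    (fun t (ht : 0 ≤ t) => hasDerivAt_neg_one_div_add (by positivity))
    (integrableOn_one_div_add_sq hr) (tendsto_neg_one_div_add r)]
  simp

theorem abs_latticeGreen_sub_le {σ : ℝ} (hσ : 0 ≤ σ) {x y : Fin 3 → ℤ} (h : lattice.Adj x y) :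
    |latticeGreen σ x - latticeGreen σ y|
      ≤ 2456 * heatConst ^ 3 / (1 + ∑ i, (x i : ℝ) ^ 2) := by
  have hr : 0 ≤ ∑ i, (x i : ℝ) ^ 2 := Finset.sum_nonneg fun i _ => sq_nonneg _
  have hK := heatConst_pos
  rw [latticeGreen_eq_integral hσ, latticeGreen_eq_integral hσ, ← mul_sub, abs_mul,
    ← integral_sub (integrableOn_exp_mul_prod_heatCoeff hσ x)
      (integrableOn_exp_mul_prod_heatCoeff hσ y)]
  have hpi : |1 / (2 * π) ^ 3| ≤ 1 := by
    rw [abs_of_pos (by positivity)]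
    exact (div_le_one (by positivity)).2 (one_le_pow₀ (by linarith [pi_gt_three]))
  refine (mul_le_of_le_one_left (abs_nonneg _) hpi).trans ?_
  rw [div_eq_mul_one_div, ← integral_one_div_add_sq hr, ← integral_const_mul, ← norm_eq_abs]
  refine norm_integral_le_of_norm_le ((integrableOn_one_div_add_sq hr).const_mul _) ?_
  refine (ae_restrict_iff' measurableSet_Ioi).2 (Filter.Eventually.of_forall fun t ht => ?_)
  have ht0 : (0 : ℝ) < t := ht
  have hexp : exp (-σ * t) ≤ 1 := exp_le_one_iff.2 (by nlinarith)
  rw [← mul_sub, norm_mul, norm_of_nonneg (exp_pos _).le, ← div_eq_mul_one_div]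
  exact (mul_le_of_le_one_left (norm_nonneg _) hexp).trans (abs_prod_heatCoeff_sub_le ht0.le h)

/-! ### Schur test and decay of the double-layer kernel. -/

theorem norm_toEuclideanCLM_le_of_sum_le {ι : Type*} [Fintype ι] [DecidableEq ι]
    (A : Matrix ι ι ℝ) {R : ℝ} (hR : 0 ≤ R) (hrow : ∀ i, ∑ j, |A i j| ≤ R)
    (hcol : ∀ j, ∑ i, |A i j| ≤ R) : ‖Matrix.toEuclideanCLM (𝕜 := ℝ) A‖ ≤ R := by
  refine ContinuousLinearMap.opNorm_le_bound _ hR fun x => ?_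
  refine le_of_sq_le_sq ?_ (by positivity)
  rw [mul_pow, EuclideanSpace.real_norm_sq_eq, EuclideanSpace.real_norm_sq_eq]
  have hpt : ∀ i, (Matrix.toEuclideanCLM (𝕜 := ℝ) A x) i ^ 2 ≤ R * ∑ j, |A i j| * x j ^ 2 := by
    intro i
    have h1 : (Matrix.toEuclideanCLM (𝕜 := ℝ) A x) i = ∑ j, A i j * x j := rfl
    rw [h1]
    -- Cauchy–Schwarz with the splitting `|A i j| |x j| = |A i j|^(1/2) * (|A i j|^(1/2) |x j|)`.
    refine (Finset.sum_sq_le_sum_mul_sum_of_sq_le_mul Finset.univ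
      (f := fun j => |A i j|) (g := fun j => |A i j| * x j ^ 2)
      (fun j _ => abs_nonneg _) (fun j _ => by positivity) fun j _ => ?_).trans ?_
    · rw [mul_pow, ← sq_abs (A i j)]; exact le_of_eq (by ring)
    · exact mul_le_mul_of_nonneg_right (hrow i) (Finset.sum_nonneg fun j _ => by positivity)
  calc ∑ i, (Matrix.toEuclideanCLM (𝕜 := ℝ) A x) i ^ 2
      ≤ ∑ i, R * ∑ j, |A i j| * x j ^ 2 := Finset.sum_le_sum fun i _ => hpt i
    _ = R * ∑ j, (∑ i, |A i j|) * x j ^ 2 := by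
        rw [← Finset.mul_sum, Finset.sum_comm]
        simp only [Finset.sum_mul]
    _ ≤ R * ∑ j, R * x j ^ 2 := by
        gcongr with j
        exact hcol j
    _ = R ^ 2 * ∑ j, x j ^ 2 := by rw [← Finset.mul_sum]; ring

theorem nodeDist_sq (m n : Fin 3 → ℤ) :
    nodeDist m n ^ 2 = ∑ i, ((m i : ℝ) - (n i : ℝ)) ^ 2 :=
  Real.sq_sqrt (Finset.sum_nonneg fun _ _ => sq_nonneg _)

theorem nodeDist_comm (m n : Fin 3 → ℤ) : nodeDist m n = nodeDist n m := by
  unfold nodeDist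
  simp only [sub_sq_comm]

/-- A crude count by the surrounding box of `3³` nodes; only uniformity matters. -/
theorem card_outerNeighbors_le (M : Set (Fin 3 → ℤ)) (n : Fin 3 → ℤ) :
    (outerNeighbors_finite M n).toFinset.card ≤ 27 := by
  have hsub : (outerNeighbors_finite M n).toFinset
      ⊆ Finset.Icc (fun i => n i - 1) (fun i => n i + 1) := by
    intro k hk
    have hk' : ∑ i, |n i - k i| = 1 := ((Set.Finite.mem_toFinset _).1 hk).1
    rw [Fin.sum_univ_three] at hk'
    rw [Finset.mem_Icc, Pi.le_def, Pi.le_def, Fin.forall_fin_succ, Fin.forall_fin_two,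
      Fin.forall_fin_succ, Fin.forall_fin_two]
    change ((n 0 - 1 ≤ k 0) ∧ (n 1 - 1 ≤ k 1) ∧ (n 2 - 1 ≤ k 2)) ∧
      ((k 0 ≤ n 0 + 1) ∧ (k 1 ≤ n 1 + 1) ∧ (k 2 ≤ n 2 + 1))
    rcases abs_cases (n 0 - k 0) with h0 | h0 <;> rcases abs_cases (n 1 - k 1) with h1 | h1 <;>
      rcases abs_cases (n 2 - k 2) with h2 | h2 <;> omega
  refine (Finset.card_le_card hsub).trans ?_
  rw [Pi.card_Icc, Fin.prod_univ_three]
  simp only [Int.card_Icc]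
  have e : ∀ a : ℤ, (a + 1 + 1 - (a - 1)).toNat = 3 := fun a => by omega
  simp [e]

/-- The constant in the decay estimate of the double-layer kernel. -/
noncomputable def kernelConst : ℝ := 27 * (2456 * heatConst ^ 3)

theorem kernelConst_pos : 0 < kernelConst := by
  have := heatConst_pos
  unfold kernelConst; positivity

/-- Each summand is a difference of the Green's function along the edge from `m - n` to `m - k`. The
majorant is symmetric in `m` and `n`, so one estimate serves rows and columns. -/
theorem abs_doubleLayerKernel_le {σ : ℝ} (hσ : 0 ≤ σ) (M : Set (Fin 3 → ℤ)) (m n : Fin 3 → ℤ) :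
    |doubleLayerKernel σ M m n| ≤ kernelConst / (1 + nodeDist m n ^ 2) := by
  have hK := heatConst_pos
  have hb : 0 ≤ 2456 * heatConst ^ 3 / (1 + nodeDist m n ^ 2) := by positivity
  refine (Finset.abs_sum_le_sum_abs _ _).trans ?_
  refine (Finset.sum_le_card_nsmul _ _ (2456 * heatConst ^ 3 / (1 + nodeDist m n ^ 2))
    fun k hk => ?_).trans ?_
  · have hadj : lattice.Adj (m - n) (m - k) := by
      have hk' : ∑ i, |n i - k i| = 1 := ((Set.Finite.mem_toFinset _).1 hk).1
      change ∑ i, |(m i - n i) - (m i - k i)| = 1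
      simpa [abs_sub_comm] using hk'
    refine (abs_latticeGreen_sub_le hσ hadj).trans_eq ?_
    rw [nodeDist_sq]
    simp
  · rw [nsmul_eq_mul, kernelConst, mul_div_assoc 27]
    have hcard : ((outerNeighbors_finite M n).toFinset.card : ℝ) ≤ 27 := by
      exact_mod_cast card_outerNeighbors_le M n
    exact mul_le_mul_of_nonneg_right hcard hb

/-! ### Summation along the cyclic ordering. -/

/-- `∑_{k ∈ ℤ} 1 / (1 + k²)`. -/
noncomputable def invSqSum : ℝ := ∑' k : ℤ, 1 / (1 + (k : ℝ) ^ 2)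

theorem summable_one_div_one_add_sq : Summable fun k : ℤ => 1 / (1 + (k : ℝ) ^ 2) := by
  have h : Summable fun k : ℤ => 1 / (k : ℝ) ^ 2 := Real.summable_one_div_int_pow.2 one_lt_two
  refine Summable.of_norm_bounded_eventually h ?_
  filter_upwards [(Set.finite_singleton (0 : ℤ)).compl_mem_cofinite] with k hk
  have hk0 : (k : ℝ) ≠ 0 := Int.cast_ne_zero.2 hk
  rw [Real.norm_of_nonneg (by positivity)]
  exact one_div_le_one_div_of_le (by positivity) (by linarith)

theorem sum_one_div_one_add_sq_le {ι : Type*} [Fintype ι] {f : ι → ℤ}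
    (hf : Function.Injective f) : ∑ j, 1 / (1 + (f j : ℝ) ^ 2) ≤ invSqSum := by
  rw [← tsum_fintype (L := .unconditional ι)]
  exact (summable_one_div_one_add_sq.comp_injective hf).tsum_le_tsum_of_inj f hf
    (fun k _ => by positivity) (fun j => le_rfl) summable_one_div_one_add_sq

theorem one_le_invSqSum : 1 ≤ invSqSum := by
  have h := sum_one_div_one_add_sq_le (ι := Unit) (f := fun _ => 0)
    (Function.injective_of_subsingleton _)
  simpa using h

/-- Up to sign, the cyclic distance is one of `i - j`, `N - (i - j)`, `N + (i - j)`, each injective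
in `j`; hence three copies of the full series. -/
theorem sum_one_div_one_add_cyclicDist_sq_le {N : ℕ} (i : Fin N) :
    ∑ j, 1 / (1 + (cyclicDist i j : ℝ) ^ 2) ≤ 3 * invSqSum := by
  have hinj : Function.Injective fun j : Fin N => (j : ℤ) := fun a b h =>
    Fin.ext (Int.ofNat.inj h)
  have h1 := sum_one_div_one_add_sq_le (f := fun j : Fin N => (i : ℤ) - j) fun a b h =>
    hinj (by simpa using h)
  have h2 := sum_one_div_one_add_sq_le (f := fun j : Fin N => (N : ℤ) - ((i : ℤ) - j))
    fun a b h => hinj (by simpa using h)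
  have h3 := sum_one_div_one_add_sq_le (f := fun j : Fin N => (N : ℤ) + ((i : ℤ) - j))
    fun a b h => hinj (by simpa using h)
  have hpt : ∀ j : Fin N, 1 / (1 + (cyclicDist i j : ℝ) ^ 2)
      ≤ 1 / (1 + (((i : ℤ) - j : ℤ) : ℝ) ^ 2) + 1 / (1 + (((N : ℤ) - ((i : ℤ) - j) : ℤ) : ℝ) ^ 2)
        + 1 / (1 + (((N : ℤ) + ((i : ℤ) - j) : ℤ) : ℝ) ^ 2) := by
    intro j
    have p1 : 0 ≤ 1 / (1 + (((i : ℤ) - j : ℤ) : ℝ) ^ 2) := by positivity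
    have p2 : 0 ≤ 1 / (1 + (((N : ℤ) - ((i : ℤ) - j) : ℤ) : ℝ) ^ 2) := by positivity
    have p3 : 0 ≤ 1 / (1 + (((N : ℤ) + ((i : ℤ) - j) : ℤ) : ℝ) ^ 2) := by positivity
    have hcases : cyclicDist i j = (i : ℤ) - j ∨ cyclicDist i j = -((i : ℤ) - j) ∨
        cyclicDist i j = (N : ℤ) - ((i : ℤ) - j) ∨ cyclicDist i j = (N : ℤ) + ((i : ℤ) - j) := by
      unfold cyclicDist
      rcases abs_cases ((i : ℤ) - j) with h | h <;> omega
    rcases hcases with h | h | h | h <;> rw [h]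
    · linarith
    · rw [Int.cast_neg, neg_sq]; linarith
    · linarith
    · linarith
  refine (Finset.sum_le_sum fun j _ => hpt j).trans ?_
  rw [Finset.sum_add_distrib, Finset.sum_add_distrib]
  linarith

theorem cyclicDist_nonneg {N : ℕ} (i j : Fin N) : 0 ≤ cyclicDist i j := by
  unfold cyclicDist
  rcases abs_cases ((i : ℤ) - j) with h | h <;> omega

theorem cyclicDist_self {N : ℕ} (i : Fin N) : cyclicDist i i = 0 := by
  unfold cyclicDist; simp

theorem sum_one_div_one_add_nodeDist_sq_le {N : ℕ} (p : Fin N → Fin 3 → ℤ) {c : ℝ} (hc : 0 < c)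
    (hc1 : c ≤ 1)
    (h : ∀ i j : Fin N, i ≠ j → c * (cyclicDist i j : ℝ) ≤ nodeDist (p i) (p j)) (i : Fin N) :
    ∑ j, 1 / (1 + nodeDist (p i) (p j) ^ 2) ≤ 3 * invSqSum / c ^ 2 := by
  rw [le_div_iff₀ (by positivity), Finset.sum_mul]
  refine (Finset.sum_le_sum fun j _ => ?_).trans (sum_one_div_one_add_cyclicDist_sq_le i)
  have hd : c * (cyclicDist i j : ℝ) ≤ nodeDist (p i) (p j) := by
    rcases eq_or_ne i j with rfl | hij
    · rw [cyclicDist_self, Int.cast_zero, mul_zero]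
      exact Real.sqrt_nonneg _
    · exact h i j hij
  have hd0 : (0 : ℝ) ≤ cyclicDist i j := by exact_mod_cast cyclicDist_nonneg i j
  have hsq : (c * (cyclicDist i j : ℝ)) ^ 2 ≤ nodeDist (p i) (p j) ^ 2 :=
    pow_le_pow_left₀ (by positivity) hd 2
  -- This gives `c² (1 + d²) ≤ 1 + c² d²`, so a factor `c⁻²` can be pulled out of every term,
  -- including the diagonal one.
  have hcsq : c ^ 2 ≤ 1 := pow_le_one₀ hc.le hc1
  rw [div_mul_eq_mul_div, one_mul, div_le_div_iff₀ (by positivity) (by positivity)]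
  nlinarith

end LatticeBAE

/-! ### The operator norm bound. -/

theorem mainTheorem2 :
    ∃ C : ℝ, 0 < C ∧
      ∀ (σ : ℝ), 0 ≤ σ →
      ∀ (Ωh : Set (Fin 3 → ℤ)), (LatticeBAE.lattice.induce Ωh).Connected →
      ∀ [Fintype (LatticeBAE.gammaMinus Ωh)] (N : ℕ) (m : Fin N ≃ LatticeBAE.gammaMinus Ωh)
        (c : ℝ), 0 < c → c ≤ 1 →
        (∀ i j : Fin N, i ≠ j →
          c * (LatticeBAE.cyclicDist i j : ℝ) ≤ LatticeBAE.nodeDist (m i) (m j)) →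
        ‖Matrix.toEuclideanCLM (𝕜 := ℝ) (LatticeBAE.doubleLayerMatrix σ Ωh)‖ ≤ C / c ^ 2 := by
  have hK := LatticeBAE.kernelConst_pos
  have hS := LatticeBAE.one_le_invSqSum
  refine ⟨LatticeBAE.kernelConst * (3 * LatticeBAE.invSqSum), by positivity, ?_⟩
  intro σ hσ Ωh _ _ N m c hc hc1 hsep
  have hrow : ∀ a : LatticeBAE.gammaMinus Ωh,
      ∑ b : LatticeBAE.gammaMinus Ωh, LatticeBAE.kernelConst /
        (1 + LatticeBAE.nodeDist a b ^ 2)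
      ≤ LatticeBAE.kernelConst * (3 * LatticeBAE.invSqSum) / c ^ 2 := by
    intro a
    obtain ⟨i, rfl⟩ := m.surjective a
    rw [← Equiv.sum_comp m, mul_div_assoc]
    simp only [div_eq_mul_one_div LatticeBAE.kernelConst, ← Finset.mul_sum]
    exact mul_le_mul_of_nonneg_left (LatticeBAE.sum_one_div_one_add_nodeDist_sq_le
      (fun j => (m j : Fin 3 → ℤ)) hc hc1 hsep i) hK.le
  refine LatticeBAE.norm_toEuclideanCLM_le_of_sum_le _ (by positivity) (fun a => ?_) fun b => ?_
  · exact le_trans (Finset.sum_le_sum fun b _ =>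
      LatticeBAE.abs_doubleLayerKernel_le hσ Ωh a.1 b.1) (hrow a)
  · refine le_trans (Finset.sum_le_sum fun a _ =>
      LatticeBAE.abs_doubleLayerKernel_le hσ Ωh a.1 b.1) ?_
    simp only [LatticeBAE.nodeDist_comm _ b.1]
    exact hrow b
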